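/- For a real number $\alpha$ let $\Gamma_\alpha=\{s\in\mathbb C : \operatorname{Re} s>-\alpha\}$, and let $H^2(\Gamma_\alpha)$ be the space of all holomorphic functions $f:\Gamma_\alpha\to\mathbb C$ with $$\|f\|_{H^2(\Gamma_\alpha)}=\sup_{x>-\alpha}\left(\int_{-\infty}^{\infty}|f(x+iy)|^2\,dy\right)^{1/2}<\infty .$$ A complex RKHS over a nonempty set $S$ is a complex Hilbert space $H$ of functions $S\to\mathbb C$ (with pointwise operations) such that, for each $s\in S$, the evaluation functional $H\to\mathbb C$, $f\mapsto f(s)$, is continuous; its reproducing kernel is the unique function $k:S\times S\to\mathbb C$ with $k(\cdot,s)\in H$ and $f(s)=\langle f,k(\cdot,s)\rangle_H$ for all $s\in S$, $f\in H$ (the inner product being linear in its first argument). A kernel $k:S\times S\to\mathbb C$ is positive definite if $\sum_{i,j=1}^n a_i^*a_j\,k(s_i,s_j)$ is real and $\ge 0$ for all $n\ge 1$, $s_1,\dots,s_n\in S$ and $a_1,\dots,a_n\in\mathbb C$, where $^*$ denotes complex conjugation; it is strictly positive definite if moreover the matrix $(k(s_i,s_j))_{1\le i,j\le n}$ is invertible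 whenever $s_1,\dots,s_n$ are distinct. **Theorem.** For every real $\alpha$, the space $H^2(\Gamma_\alpha)$ is a complex RKHS over $\Gamma_\alpha$: its norm $\|\cdot\|_{H^2(\Gamma_\alpha)}$ is induced by an inner product that makes it a Hilbert space, and the evaluation functionals are continuous. Its reproducing kernel is $$k_\alpha(s,s_0)=\frac{1}{2\pi\,(2\alpha+s+s_0^*)},\qquad s,s_0\in\Gamma_\alpha,$$ and $k_\alpha$ is strictly positive definite. -/

import Mathlib

open scoped ENNReal

/-- The shifted open right half-plane `Re s > -α`. -/
def halfPlane (α : ℝ) : Set ℂ := {s : ℂ | -α < s.re}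

/-- The point `x + i y` of the half-plane, for `x > -α`. -/
def halfPlane.point {α : ℝ} (x : Set.Ioi (-α)) (y : ℝ) : halfPlane α :=
  ⟨((x : ℝ) : ℂ) + (y : ℂ) * Complex.I, by
    have h : -α < (x : ℝ) := x.2
    simpa only [halfPlane, Set.mem_ofPred_eq, Complex.add_re, Complex.ofReal_re, Complex.re_ofReal_mul,
      Complex.I_re, mul_zero, add_zero] using h⟩

/-- Holomorphy of a function that is defined on the half-plane only. -/
def IsHolomorphic {α : ℝ} (f : halfPlane α → ℂ) : Prop :=
  ∃ F : ℂ → ℂ, DifferentiableOn ℂ F (halfPlane α) ∧ ∀ s : halfPlane α, F s = f s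

/-- `sup_{x > -α} (∫ |f(x + iy)|² dy)^{1/2}`, with values in `[0, ∞]`. -/
noncomputable def hardyENorm {α : ℝ} (f : halfPlane α → ℂ) : ℝ≥0∞ :=
  ⨆ x : Set.Ioi (-α), (∫⁻ y : ℝ, ‖f (halfPlane.point x y)‖ₑ ^ 2) ^ (1 / 2 : ℝ)

section helpers

variable {α : ℝ}

theorem IsHolomorphic.continuous {f : halfPlane α → ℂ} (hf : IsHolomorphic f) :
    Continuous f := by
  obtain ⟨F, hF, h⟩ := hf
  have h1 := continuousOn_iff_continuous_domRestrict.mp hF.continuousOn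
  convert h1 using 1
  ext s
  exact (h s).symm

theorem halfPlane.continuous_point (x : Set.Ioi (-α)) :
    Continuous (halfPlane.point x) := by
  unfold halfPlane.point
  fun_prop

theorem hardyENorm_eq (f : halfPlane α → ℂ) :
    hardyENorm f = ⨆ x : Set.Ioi (-α),
      MeasureTheory.eLpNorm (fun y : ℝ => f (halfPlane.point x y)) 2 MeasureTheory.volume := by
  simp [hardyENorm, MeasureTheory.eLpNorm_eq_lintegral_rpow_enorm_toReal]

theorem hardyENorm_zero : hardyENorm (0 : halfPlane α → ℂ) = 0 := by
  simp [hardyENorm]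

theorem hardyENorm_add_le {f g : halfPlane α → ℂ} (hf : IsHolomorphic f)
    (hg : IsHolomorphic g) : hardyENorm (f + g) ≤ hardyENorm f + hardyENorm g := by
  simp only [hardyENorm_eq]
  refine iSup_le fun x => ?_
  refine le_trans (MeasureTheory.eLpNorm_add_le
    (hf.continuous.comp (halfPlane.continuous_point x)).aestronglyMeasurable
    (hg.continuous.comp (halfPlane.continuous_point x)).aestronglyMeasurable (by norm_num)) ?_
  exact add_le_add (le_iSup (fun x : Set.Ioi (-α) => MeasureTheory.eLpNorm
      (fun y : ℝ => f (halfPlane.point x y)) 2 MeasureTheory.volume) x)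
    (le_iSup (fun x : Set.Ioi (-α) => MeasureTheory.eLpNorm
      (fun y : ℝ => g (halfPlane.point x y)) 2 MeasureTheory.volume) x)

theorem hardyENorm_smul (c : ℂ) (f : halfPlane α → ℂ) :
    hardyENorm (c • f) = ‖c‖ₑ * hardyENorm f := by
  simp only [hardyENorm_eq, ENNReal.mul_iSup]
  refine iSup_congr fun x => ?_
  exact MeasureTheory.eLpNorm_const_smul c (fun y : ℝ => f (halfPlane.point x y)) 2 _

theorem eq_zero_of_hardyENorm {f : halfPlane α → ℂ} (hf : IsHolomorphic f)
    (h : hardyENorm f = 0) : f = 0 := by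
  ext s
  rw [hardyENorm_eq, ENNReal.iSup_eq_zero] at h
  let x : Set.Ioi (-α) := ⟨(s : ℂ).re, s.2⟩
  have hc : Continuous fun y : ℝ => f (halfPlane.point x y) :=
    hf.continuous.comp (halfPlane.continuous_point x)
  have h1 := (MeasureTheory.eLpNorm_eq_zero_iff hc.aestronglyMeasurable (by norm_num)).mp (h x)
  have h2 := (MeasureTheory.Measure.eq_of_ae_eq h1 hc continuous_const)
  have h3 := congrFun h2 (s : ℂ).im
  have h4 : halfPlane.point x (s : ℂ).im = s := Subtype.ext (Complex.re_add_im _)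
  simpa [h4] using h3

end helpers

/-- The Hardy space as a linear subspace of the space of all functions on the half-plane:
the holomorphic functions with finite Hardy norm. -/
def hardySubmodule (α : ℝ) : Submodule ℂ (halfPlane α → ℂ) where
  carrier := {f | IsHolomorphic f ∧ hardyENorm f < ∞}
  zero_mem' := ⟨⟨0, differentiableOn_const 0, fun _ => rfl⟩, by simp [hardyENorm_zero]⟩
  add_mem' := by
    rintro f g ⟨hf, hf'⟩ ⟨hg, hg'⟩
    refine ⟨?_, (hardyENorm_add_le hf hg).trans_lt (ENNReal.add_lt_top.mpr ⟨hf', hg'⟩)⟩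
    obtain ⟨F, hF, hFf⟩ := hf
    obtain ⟨G, hG, hGg⟩ := hg
    exact ⟨F + G, hF.add hG, fun s => by simp [hFf, hGg]⟩
  smul_mem' := by
    rintro c f ⟨⟨F, hF, hFf⟩, hf'⟩
    refine ⟨⟨c • F, hF.const_smul c, fun s => by simp [hFf]⟩, ?_⟩
    rw [hardyENorm_smul]
    exact ENNReal.mul_lt_top (by simp) hf'

/-- The Hardy space `H²(Γ_α)`. It is a separate type so that it carries the topology of its
norm and not the topology of pointwise convergence. -/
def HardySpace (α : ℝ) : Type := hardySubmodule α

namespace HardySpace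

variable {α : ℝ}

/-- The function on the half-plane that an element of the Hardy space is. -/
def toFun (f : HardySpace α) : halfPlane α → ℂ := f.1

noncomputable instance : AddCommGroup (HardySpace α) :=
  inferInstanceAs (AddCommGroup (hardySubmodule α))

noncomputable instance : Module ℂ (HardySpace α) :=
  inferInstanceAs (Module ℂ (hardySubmodule α))

/-- The Hardy norm `‖f‖ = sup_{x > -α} (∫ |f(x + iy)|² dy)^{1/2}`. -/
noncomputable instance : Norm (HardySpace α) := ⟨fun f => (hardyENorm f.toFun).toReal⟩

theorem norm_add_le' (f g : HardySpace α) : ‖f + g‖ ≤ ‖f‖ + ‖g‖ := by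
  have h := hardyENorm_add_le f.2.1 g.2.1
  have h1 := ENNReal.toReal_mono (ENNReal.add_lt_top.mpr ⟨f.2.2, g.2.2⟩).ne h
  rwa [ENNReal.toReal_add f.2.2.ne g.2.2.ne] at h1

theorem norm_smul' (c : ℂ) (f : HardySpace α) : ‖c • f‖ = ‖c‖ * ‖f‖ := by
  have h := congrArg ENNReal.toReal (hardyENorm_smul c f.toFun)
  rw [ENNReal.toReal_mul, toReal_enorm] at h
  exact h

noncomputable instance : NormedAddCommGroup (HardySpace α) :=
  AddGroupNorm.toNormedAddCommGroup
    { toFun := fun f => ‖f‖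
      map_zero' := by
        change (hardyENorm (0 : halfPlane α → ℂ)).toReal = 0
        simp [hardyENorm_zero]
      add_le' := norm_add_le'
      neg' := fun f => by simpa using norm_smul' (-1) f
      eq_zero_of_map_eq_zero' := fun f hf => by
        refine Subtype.ext (eq_zero_of_hardyENorm f.2.1 ?_)
        exact ((ENNReal.toReal_eq_zero_iff _).mp hf).resolve_right f.2.2.ne }

noncomputable instance : NormedSpace ℂ (HardySpace α) where
  norm_smul_le c f := (norm_smul' c f).le

end HardySpace

/-- The Szegő kernel of the half-plane. -/
noncomputable def szegoKernel (α : ℝ) (s s₀ : halfPlane α) : ℂ :=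
  1 / (2 * Real.pi * (2 * α + s + star (s₀ : ℂ)))

open scoped ComplexOrder in
/-- A complex kernel `k` is positive definite if all its quadratic forms
`∑ aᵢ^* aⱼ k(sᵢ, sⱼ)` are real and nonnegative (`≤` on `ℂ` entails equal imaginary parts). -/
def IsPosDefKernel {S : Type*} (k : S → S → ℂ) : Prop :=
  ∀ (n : ℕ) (s : Fin n → S) (a : Fin n → ℂ),
    0 ≤ ∑ i, ∑ j, star (a i) * a j * k (s i) (s j)

/-- A positive definite kernel is strictly positive definite if the kernel matrix of any finite
family of distinct points is invertible. -/
def IsStrictlyPosDefKernel {S : Type*} (k : S → S → ℂ) : Prop :=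
  IsPosDefKernel k ∧ ∀ (n : ℕ) (s : Fin n → S), Function.Injective s →
    IsUnit (Matrix.of fun i j : Fin n => k (s i) (s j))

/-! Everything happens on vertical lines inside the open half-plane; boundary values on `Re s = -α`
are never needed.

Point evaluations are bounded because the area integral of `|F|²` over a disc is at most the
integral over a vertical strip, which the Hardy norm controls (`enorm_le_of_eLpNorm_vertical_le`).
The bound is uniform on smaller half-planes, so a Cauchy sequence converges locally uniformly;
Fatou's lemma on each line then gives completeness.

The `L²` norm over `Re s = x` decreases in `x` (`eLpNorm_vertical_antitone`, by duality and
Phragmén–Lindelöf). The supremum is therefore a limit as `x → -α`, the parallelogram law passes to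
it from `L²(ℝ)`, and the inner product is the limit of the `L²` inner products.

On the line `Re s = x` the conjugate of `k_α(·, s₀)` is `1 / 2π` times the Cauchy kernel of `w = s₀
+ 2α + 2x`. Cauchy's formula (`integral_vertical_cauchy`) makes the `L²` pairing equal to `F w`, and
`w → s₀` as `x → -α`: this is the reproducing property. Positive definiteness follows since `k_α` is
a Gram kernel, and strictness since its matrices are Cauchy matrices. -/

open MeasureTheory Set Filter Topology

/-! ### Bounding point values by area integrals. -/

/-- Cauchy–Schwarz for an integral of a product. -/
theorem enorm_integral_mul_le_eLpNorm_two {X : Type*} [MeasurableSpace X] {μ : Measure X}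
    {f g : X → ℂ} (hf : AEStronglyMeasurable f μ) (hg : AEStronglyMeasurable g μ) :
    ‖∫ x, f x * g x ∂μ‖ₑ ≤ eLpNorm f 2 μ * eLpNorm g 2 μ := by
  refine (enorm_integral_le_lintegral_enorm _).trans ?_
  rw [← eLpNorm_one_eq_lintegral_enorm]
  exact eLpNorm_smul_le_mul_eLpNorm (𝕜 := ℂ) (E := ℂ) (p := 2) (q := 2) (r := 1) hg hf

/-- The `L²` norm squared as a Lebesgue integral. -/
theorem eLpNorm_two_sq {X : Type*} [MeasurableSpace X] {μ : Measure X} (f : X → ℂ) :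
    eLpNorm f 2 μ ^ 2 = ∫⁻ x, ‖f x‖ₑ ^ 2 ∂μ := by
  rw [eLpNorm_eq_lintegral_rpow_enorm_toReal (by norm_num) (by norm_num),
    ← ENNReal.rpow_natCast, ← ENNReal.rpow_mul]
  simp

theorem isOpen_halfPlane (α : ℝ) : IsOpen (halfPlane α) :=
  isOpen_lt continuous_const Complex.continuous_re

theorem mem_halfPlane {α : ℝ} {s : ℂ} : s ∈ halfPlane α ↔ -α < s.re := Iff.rfl

/-- A holomorphic function on a half-plane is continuous along translated vertical lines. -/
theorem DifferentiableOn.continuous_vertical {α : ℝ} {F : ℂ → ℂ}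
    (hF : DifferentiableOn ℂ F (halfPlane α)) {s : ℂ} (hs : s ∈ halfPlane α) :
    Continuous fun y : ℝ => F (s + y * Complex.I) := by
  refine hF.continuousOn.comp_continuous (by fun_prop) fun y => ?_
  simpa [mem_halfPlane] using hs

/-- `F ^ 2` is itself holomorphic, so its mean value property and the triangle inequality suffice;
no subharmonicity of `|F|²` is invoked. The angles run over `(-π, π)` to match polar coordinates. -/
theorem lintegral_circleMap_ge {F : ℂ → ℂ} {s : ℂ} {ρ r : ℝ} (hρ : 0 < ρ) (hr : ρ < r)
    (hF : DifferentiableOn ℂ F (Metric.ball s r)) :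
    ENNReal.ofReal (2 * Real.pi) * ‖F s‖ₑ ^ 2 ≤
      ∫⁻ θ in Ioo (-Real.pi) Real.pi, ‖F (circleMap s ρ θ)‖ₑ ^ 2 := by
  have hd : DiffContOnCl ℂ (fun z => F z ^ 2) (Metric.ball s |ρ|) := by
    refine DifferentiableOn.diffContOnCl ((hF.pow 2).mono ?_)
    rw [closure_ball _ (by positivity), abs_of_pos hρ]
    exact Metric.closedBall_subset_ball hr
  have h := hd.circleAverage
  rw [Real.circleAverage_eq_integral_add (-Real.pi),
    intervalIntegral.integral_comp_add_right (fun θ => F (circleMap s ρ θ) ^ 2)] at h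
  have h2 : ((2 * Real.pi : ℝ) : ℂ) * F s ^ 2 =
      ∫ θ in (-Real.pi)..Real.pi, F (circleMap s ρ θ) ^ 2 := by
    have e1 : (0 : ℝ) + -Real.pi = -Real.pi := by ring
    have e2 : 2 * Real.pi + -Real.pi = Real.pi := by ring
    rw [← h, e1, e2, Complex.real_smul, ← mul_assoc, ← Complex.ofReal_mul,
      mul_inv_cancel₀ (by positivity), Complex.ofReal_one, one_mul]
  have h3 := congrArg (‖·‖ₑ) h2
  simp only [enorm_mul, enorm_pow] at h3
  rw [show ‖((2 * Real.pi : ℝ) : ℂ)‖ₑ = ENNReal.ofReal (2 * Real.pi) by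
    rw [← ofReal_norm, Complex.norm_real, Real.norm_of_nonneg (by positivity)],
    intervalIntegral.integral_of_le (by linarith [Real.pi_pos]),
    ← MeasureTheory.integral_Ioc_eq_integral_Ioo.symm] at h3
  rw [h3]
  refine (enorm_integral_le_lintegral_enorm _).trans_eq ?_
  simp

/-- Sub-mean value property over discs: `π r² |F(s)|² ≤ ∫_{|z-s|<r} |F|²`. -/
theorem enorm_sq_le_lintegral_ball {F : ℂ → ℂ} {s : ℂ} {r : ℝ} (hr : 0 < r)
    (hF : DifferentiableOn ℂ F (Metric.ball s r)) :
    ENNReal.ofReal (Real.pi * r ^ 2) * ‖F s‖ₑ ^ 2 ≤ ∫⁻ z in Metric.ball s r, ‖F z‖ₑ ^ 2 := by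
  set g : ℂ → ℝ≥0∞ := (Metric.ball s r).indicator fun z => ‖F z‖ₑ ^ 2 with hg
  have hgm : Measurable g := by
    classical
    rw [hg, ← Set.piecewise_eq_indicator]
    refine ContinuousOn.measurable_piecewise ?_ continuousOn_const Metric.isOpen_ball.measurableSet
    exact (ENNReal.continuous_pow 2).comp_continuousOn
      (continuous_enorm.comp_continuousOn hF.continuousOn)
  rw [← lintegral_indicator Metric.isOpen_ball.measurableSet, ← hg,
    ← lintegral_add_left_eq_self g s, ← Complex.lintegral_comp_polarCoord_symm]
  rw [polarCoord_target, Measure.volume_eq_prod, ← Measure.prod_restrict, lintegral_prod]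
  swap
  · refine ((ENNReal.measurable_ofReal.comp measurable_fst).mul (hgm.comp ?_)).aemeasurable
    refine Continuous.measurable ?_
    simp only [Complex.polarCoord_symm_apply]
    fun_prop
  calc ENNReal.ofReal (Real.pi * r ^ 2) * ‖F s‖ₑ ^ 2
      = ∫⁻ ρ in Ioo 0 r, ENNReal.ofReal ρ * (ENNReal.ofReal (2 * Real.pi) * ‖F s‖ₑ ^ 2) := by
        rw [lintegral_mul_const _ (by fun_prop), ← ofReal_integral_eq_lintegral_ofReal,
          ← integral_Ioc_eq_integral_Ioo, ← intervalIntegral.integral_of_le hr.le, integral_id,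
          ← mul_assoc, ← ENNReal.ofReal_mul (by simp only [ne_eq, OfNat.ofNat_ne_zero,
            not_false_eq_true, zero_pow, sub_zero]; positivity)]
        · congr 2
          ring
        · exact (continuous_id.integrableOn_Icc).mono_set Ioo_subset_Icc_self
        · exact (ae_restrict_mem measurableSet_Ioo).mono fun ρ hρ => hρ.1.le
    _ ≤ ∫⁻ ρ in Ioo 0 r, ∫⁻ θ in Ioo (-Real.pi) Real.pi,
          ENNReal.ofReal ρ • g (s + Complex.polarCoord.symm (ρ, θ)) := by
        refine setLIntegral_mono' measurableSet_Ioo fun ρ hρ => ?_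
        simp only [smul_eq_mul]
        rw [lintegral_const_mul' _ _ ENNReal.ofReal_ne_top]
        refine mul_le_mul_right ((lintegral_circleMap_ge hρ.1 hρ.2 hF).trans_eq ?_) _
        refine lintegral_congr fun θ => ?_
        have e : s + Complex.polarCoord.symm (ρ, θ) = circleMap s ρ θ := by
          rw [Complex.polarCoord_symm_apply, circleMap, Complex.exp_mul_I]
          push_cast
          ring
        rw [e, hg, Set.indicator_of_mem]
        rw [mem_ball_iff_norm, circleMap_sub_center, norm_circleMap_zero, abs_of_pos hρ.1]
        exact hρ.2
    _ ≤ _ := lintegral_mono_set Ioo_subset_Ioi_self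

/-- Point evaluation is bounded by the `L²` norms along vertical lines. -/
theorem enorm_sq_le_of_eLpNorm_vertical_le {α : ℝ} {F : ℂ → ℂ} {C : ℝ≥0∞}
    (hF : DifferentiableOn ℂ F (halfPlane α))
    (hC : ∀ x : ℝ, -α < x → eLpNorm (fun y : ℝ => F (x + y * Complex.I)) 2 ≤ C)
    {s : ℂ} {r : ℝ} (hr : 0 < r) (hs : r < s.re + α) :
    ENNReal.ofReal (Real.pi * r ^ 2) * ‖F s‖ₑ ^ 2 ≤ ENNReal.ofReal (2 * r) * C ^ 2 := by
  have hsub : Metric.ball s r ⊆ halfPlane α := fun z hz => by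
    have h1 := (Complex.abs_re_le_norm (z - s)).trans_lt (mem_ball_iff_norm.mp hz)
    rw [Complex.sub_re, abs_lt] at h1
    rw [mem_halfPlane]
    linarith [h1.1]
  -- The disc is enlarged to the full vertical strip of width `2 * r`, where Tonelli integrates line
  -- by line.
  refine (enorm_sq_le_lintegral_ball hr (hF.mono hsub)).trans ?_
  have hsub2 : Metric.ball s r ⊆ Complex.measurableEquivRealProd ⁻¹'
      (Ioo (s.re - r) (s.re + r) ×ˢ univ) := fun z hz => by
    have h1 := (Complex.abs_re_le_norm (z - s)).trans_lt (mem_ball_iff_norm.mp hz)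
    rw [Complex.sub_re, abs_lt] at h1
    simp only [Complex.measurableEquivRealProd_apply, mem_preimage, mem_prod, mem_Ioo, mem_univ,
      and_true]
    constructor <;> linarith [h1.1, h1.2]
  refine (lintegral_mono_set hsub2).trans ?_
  have h3 := Complex.volume_preserving_equiv_real_prod.setLIntegral_comp_preimage_emb
    Complex.measurableEquivRealProd.measurableEmbedding
    (fun p => ‖F (p.1 + p.2 * Complex.I)‖ₑ ^ 2) (Ioo (s.re - r) (s.re + r) ×ˢ univ)
  simp only [Complex.measurableEquivRealProd_apply, Complex.re_add_im] at h3
  rw [h3, Measure.volume_eq_prod, ← Measure.prod_restrict, Measure.restrict_univ]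
  refine (lintegral_prod_le _).trans ?_
  calc ∫⁻ x in Ioo (s.re - r) (s.re + r), ∫⁻ y : ℝ, ‖F (x + y * Complex.I)‖ₑ ^ 2
      ≤ ∫⁻ _ in Ioo (s.re - r) (s.re + r), C ^ 2 := by
        refine setLIntegral_mono' measurableSet_Ioo fun x hx => ?_
        rw [← eLpNorm_two_sq]
        exact pow_le_pow_left' (hC x (by linarith [hx.1])) 2
    _ = ENNReal.ofReal (2 * r) * C ^ 2 := by
        rw [lintegral_const, Measure.restrict_apply_univ, Real.volume_Ioo, mul_comm]
        congr 2
        ring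

/-! ### Monotonicity of the norms over vertical lines. -/

theorem eLpNorm_vertical_translate {α : ℝ} {F : ℂ → ℂ} (hF : DifferentiableOn ℂ F (halfPlane α))
    {s : ℂ} (hs : s ∈ halfPlane α) :
    eLpNorm (fun y : ℝ => F (s + y * Complex.I)) 2 =
      eLpNorm (fun y : ℝ => F (s.re + y * Complex.I)) 2 := by
  have h : s.re ∈ Ioi (-α) := hs
  rw [← eLpNorm_comp_measurePreserving (DifferentiableOn.continuous_vertical hF (s := (s.re : ℂ))
    (by simpa [mem_halfPlane] using hs)).aestronglyMeasurable
    (measurePreserving_add_left volume s.im)]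
  congr 1
  ext y
  simp only [Function.comp_apply]
  congr 1
  conv_lhs => rw [← Complex.re_add_im s]
  push_cast
  ring

/-- Differentiation under the integral sign: over a compact interval, `deriv F` is bounded on the
compact set swept out by a small closed disc, which gives the dominating function. -/
theorem differentiableOn_integral_vertical {α : ℝ} {F : ℂ → ℂ}
    (hF : DifferentiableOn ℂ F (halfPlane α)) {h : ℝ → ℂ} (hh : Continuous h) (T : ℝ) :
    DifferentiableOn ℂ (fun s => ∫ y in (-T)..T, F (s + y * Complex.I) * h y) (halfPlane α) := by
  intro s hs
  obtain ⟨δ, hδ, hball⟩ := Metric.nhds_basis_closedBall.mem_iff.mp ((isOpen_halfPlane α).mem_nhds hs)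
  have hmem : ∀ z ∈ halfPlane α, ∀ y : ℝ, z + y * Complex.I ∈ halfPlane α := fun z hz y => by
    simpa [mem_halfPlane] using hz
  obtain ⟨M, hM⟩ := (((isCompact_closedBall s δ).prod (isCompact_uIcc (a := -T) (b := T))).image
    (f := fun p : ℂ × ℝ => p.1 + p.2 * Complex.I) (by fun_prop)).exists_bound_of_continuousOn
    (f := deriv F) ((hF.deriv (isOpen_halfPlane α)).continuousOn.mono (by
      rintro _ ⟨p, hp, rfl⟩
      exact hmem _ (hball hp.1) _))
  have hd : ∀ z ∈ halfPlane α, ∀ y : ℝ, HasDerivAt (fun z => F (z + y * Complex.I) * h y)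
      (deriv F (z + y * Complex.I) * h y) z := fun z hz y =>
    ((hF.differentiableAt ((isOpen_halfPlane α).mem_nhds (hmem z hz y))).hasDerivAt.comp_add_const
      z _).mul_const _
  have hc : ∀ z ∈ halfPlane α, Continuous fun y : ℝ => F (z + y * Complex.I) * h y := fun z hz =>
    (hF.continuous_vertical hz).mul hh
  refine DifferentiableAt.differentiableWithinAt (HasDerivAt.differentiableAt
    (intervalIntegral.hasDerivAt_integral_of_dominated_loc_of_deriv_le
    (F' := fun z y => deriv F (z + y * Complex.I) * h y) (bound := fun y => M * ‖h y‖)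
    (Metric.closedBall_mem_nhds s hδ) ?_ ((hc s hs).intervalIntegrable _ _) ?_ ?_
    ((by fun_prop : Continuous fun y => M * ‖h y‖).intervalIntegrable _ _) ?_).2)
  · filter_upwards [(isOpen_halfPlane α).mem_nhds hs] with z hz
    exact (hc z hz).aestronglyMeasurable
  · exact (((hF.deriv (isOpen_halfPlane α)).continuous_vertical hs).mul hh).aestronglyMeasurable
  · refine ae_of_all _ fun y hy z hz => ?_
    rw [norm_mul]
    exact mul_le_mul_of_nonneg_right (hM _ ⟨(z, y), ⟨hz, uIoc_subset_uIcc hy⟩, rfl⟩) (norm_nonneg _)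
  · exact ae_of_all _ fun y _ z hz => hd z (hball hz) y

/-- A bounded holomorphic function on a half-plane is bounded by its supremum on any vertical
line, to the right of that line. -/
theorem norm_le_of_bounded_halfPlane {α a B C : ℝ} {G : ℂ → ℂ} (ha : -α < a)
    (hG : DifferentiableOn ℂ G (halfPlane α)) (hB : ∀ s ∈ halfPlane α, ‖G s‖ ≤ B)
    (hC : ∀ y : ℝ, ‖G (a + y * Complex.I)‖ ≤ C) {s : ℂ} (hs : a ≤ s.re) : ‖G s‖ ≤ C := by
  have hmem : ∀ z : ℂ, 0 ≤ z.re → a + z ∈ halfPlane α := fun z hz => by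
    rw [mem_halfPlane, Complex.add_re, Complex.ofReal_re]
    linarith
  -- Growth order `1 < 2` with rate `0`: the comparison function `exp (0 * ‖z‖ ^ 1)` is constant, so
  -- the growth condition is just boundedness.
  have key := PhragmenLindelof.right_half_plane_of_bounded_on_real (f := fun z => G (a + z))
    (C := C) (z := s - a) ?_ ⟨1, by norm_num, 0, ?_⟩ ?_ (fun y => hC y) (by simpa using hs)
  · simpa using key
  · refine DifferentiableOn.diffContOnCl ?_
    refine hG.comp (by fun_prop) fun z hz => hmem z ?_
    have : closure {z : ℂ | 0 < z.re} ⊆ {z : ℂ | 0 ≤ z.re} :=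
      closure_minimal (fun z (hz : 0 < z.re) => hz.le) (isClosed_le continuous_const Complex.continuous_re)
    exact this hz
  · refine Asymptotics.IsBigO.of_bound B ?_
    filter_upwards [mem_inf_of_right (mem_principal_self _)] with z hz
    simpa using hB _ (hmem z (le_of_lt hz))
  · refine isBoundedUnder_of_eventually_le (a := B) ?_
    filter_upwards [eventually_ge_atTop 0] with x hx
    exact hB _ (hmem x (by simpa using hx))

/-- The `L²` norms along vertical lines decrease to the right. -/
theorem eLpNorm_vertical_antitone {α : ℝ} {F : ℂ → ℂ} {C : ℝ≥0∞}
    (hF : DifferentiableOn ℂ F (halfPlane α)) (hCt : C ≠ ∞)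
    (hC : ∀ x : ℝ, -α < x → eLpNorm (fun y : ℝ => F (x + y * Complex.I)) 2 ≤ C)
    {a x : ℝ} (ha : -α < a) (hx : a ≤ x) :
    eLpNorm (fun y : ℝ => F (x + y * Complex.I)) 2 ≤
      eLpNorm (fun y : ℝ => F (a + y * Complex.I)) 2 := by
  have hv : ∀ x : ℝ, -α < x → Continuous fun y : ℝ => F (x + y * Complex.I) := fun x hx =>
    hF.continuous_vertical (by simpa [mem_halfPlane] using hx)
  have hcx := hv x (ha.trans_le hx)
  have main : ∀ T : ℝ, 0 ≤ T → eLpNorm (fun y : ℝ => F (x + y * Complex.I)) 2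
      (volume.restrict (Ioc (-T) T)) ≤ eLpNorm (fun y : ℝ => F (a + y * Complex.I)) 2 := by
    intro T hT
    set μ : Measure ℝ := volume.restrict (Ioc (-T) T)
    -- Duality: pairing the translates of `F` with this extremal `h` gives a bounded holomorphic `G`
    -- with `G x = e ^ 2`. Its bound on the line `Re s = a` is the norm there times `e`; cancelling
    -- one `e` gives the claim. Truncation to `[-T, T]` keeps the integral elementary.
    set h : ℝ → ℂ := fun y => star (F (x + y * Complex.I)) with hh
    have hhc : Continuous h := hcx.star
    set e := eLpNorm (fun y : ℝ => F (x + y * Complex.I)) 2 μ with he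
    have heh : eLpNorm h 2 μ = e := eLpNorm_congr_norm_ae (ae_of_all _ fun y => by simp [hh])
    have het : e ≠ ∞ :=
      ((eLpNorm_mono_measure _ Measure.restrict_le_self).trans_lt
        ((hC x (ha.trans_le hx)).trans_lt hCt.lt_top)).ne
    set G : ℂ → ℂ := fun s => ∫ y in (-T)..T, F (s + y * Complex.I) * h y with hG
    have hGd : DifferentiableOn ℂ G (halfPlane α) := differentiableOn_integral_vertical hF hhc T
    have hGe : ∀ s ∈ halfPlane α,
        ‖G s‖ₑ ≤ eLpNorm (fun y : ℝ => F (s.re + y * Complex.I)) 2 * e := by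
      intro s hs
      rw [← eLpNorm_vertical_translate hF hs, ← heh, hG]
      simp only
      rw [intervalIntegral.integral_of_le (by linarith)]
      refine (enorm_integral_mul_le_eLpNorm_two
        (hF.continuous_vertical hs).aestronglyMeasurable hhc.aestronglyMeasurable).trans ?_
      gcongr
      exact Measure.restrict_le_self
    have hGx : ‖G x‖ₑ = e ^ 2 := by
      have h1 : G x = ((∫ y, ‖F (x + y * Complex.I)‖ ^ 2 ∂μ : ℝ) : ℂ) := by
        rw [hG]
        simp only
        rw [intervalIntegral.integral_of_le (by linarith), ← integral_complex_ofReal]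
        refine integral_congr_ae (ae_of_all _ fun y => ?_)
        simp only [hh, Complex.star_def, Complex.mul_conj, Complex.normSq_eq_norm_sq]
      rw [h1, he, eLpNorm_two_sq, ← ofReal_norm, Complex.norm_real,
        Real.norm_of_nonneg (by positivity), ofReal_integral_eq_lintegral_ofReal]
      · refine lintegral_congr fun y => ?_
        rw [ENNReal.ofReal_pow (norm_nonneg _), ofReal_norm]
      · exact (hcx.norm.pow 2).integrableOn_Ioc
      · exact ae_of_all _ fun y => by positivity
    have hea : eLpNorm (fun y : ℝ => F (a + y * Complex.I)) 2 ≠ ∞ :=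
      ((hC a ha).trans_lt hCt.lt_top).ne
    have key := norm_le_of_bounded_halfPlane (B := (C * e).toReal)
      (C := (eLpNorm (fun y : ℝ => F (a + y * Complex.I)) 2 * e).toReal) ha hGd ?_ ?_
      (s := x) (by simpa using hx)
    · rw [← toReal_enorm, ENNReal.toReal_le_toReal (by simp) (ENNReal.mul_ne_top hea het), hGx,
        sq] at key
      rcases eq_or_ne e 0 with h0 | h0
      · rw [h0]
        exact zero_le
      · exact (ENNReal.mul_le_mul_iff_left h0 het).mp key
    · intro s hs
      rw [← toReal_enorm, ENNReal.toReal_le_toReal (by simp) (ENNReal.mul_ne_top hCt het)]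
      refine (hGe s hs).trans ?_
      gcongr
      exact hC _ hs
    · intro y
      rw [← toReal_enorm, ENNReal.toReal_le_toReal (by simp) (ENNReal.mul_ne_top hea het)]
      refine (hGe _ ?_).trans_eq ?_
      · simpa [mem_halfPlane] using ha
      · simp
  have hind : ∀ n : ℕ, eLpNorm ((Ioc (-(n : ℝ)) n).indicator fun y : ℝ => F (x + y * Complex.I)) 2
      ≤ eLpNorm (fun y : ℝ => F (a + y * Complex.I)) 2 := fun n => by
    rw [eLpNorm_indicator_eq_eLpNorm_restrict measurableSet_Ioc]
    exact main n (by positivity)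
  -- Fatou's lemma removes the truncation.
  refine (Lp.eLpNorm_lim_le_liminf_eLpNorm (fun n : ℕ => hcx.aestronglyMeasurable.indicator
    (measurableSet_Ioc (a := -(n : ℝ)) (b := n))) _ (ae_of_all _ fun y => ?_)).trans
    (liminf_le_of_le (by isBoundedDefault) fun b hb => ?_)
  · refine tendsto_const_nhds.congr' ?_
    filter_upwards [(tendsto_natCast_atTop_atTop (R := ℝ)).eventually_gt_atTop |y|] with n hn
    rw [abs_lt] at hn
    have hmem : y ∈ Ioc (-(n : ℝ)) n := ⟨hn.1, hn.2.le⟩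
    rw [Set.indicator_of_mem hmem]
  · obtain ⟨n, hn⟩ := hb.exists
    exact hn.trans (hind n)

/-! ### Cauchy's formula over vertical lines. -/

theorem sq_norm_vertical (p : ℂ) (y : ℝ) :
    ‖p + y * Complex.I‖ ^ 2 = p.re ^ 2 + (y + p.im) ^ 2 := by
  rw [← Complex.normSq_eq_norm_sq, Complex.normSq_apply]
  simp
  ring

theorem inv_sq_add_sq_eq {r : ℝ} (hr : 0 < r) (v y : ℝ) :
    (r ^ 2 + (y + v) ^ 2)⁻¹ = (r ^ 2)⁻¹ * (1 + ((y + v) / r) ^ 2)⁻¹ := by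
  rw [← mul_inv]
  congr 1
  field_simp

theorem integrable_inv_sq_add_sq {r : ℝ} (hr : 0 < r) (v : ℝ) :
    Integrable fun y : ℝ => (r ^ 2 + (y + v) ^ 2)⁻¹ := by
  simp_rw [inv_sq_add_sq_eq hr]
  exact ((integrable_inv_one_add_sq.comp_div hr.ne').comp_add_right v).const_mul _

theorem integral_univ_inv_sq_add_sq {r : ℝ} (hr : 0 < r) (v : ℝ) :
    ∫ y : ℝ, (r ^ 2 + (y + v) ^ 2)⁻¹ = Real.pi / r := by
  simp_rw [inv_sq_add_sq_eq hr]
  rw [integral_const_mul, integral_add_right_eq_self (fun y : ℝ => (1 + (y / r) ^ 2)⁻¹),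
    Measure.integral_comp_div (fun y : ℝ => (1 + y ^ 2)⁻¹), integral_univ_inv_one_add_sq,
    abs_of_pos hr, smul_eq_mul]
  field_simp

/-- The decay as `p.re → ∞` is what lets a contour be pushed off to the right. -/
theorem eLpNorm_inv_vertical_sq {p : ℂ} (hp : 0 < p.re) :
    eLpNorm (fun y : ℝ => (p + y * Complex.I)⁻¹) 2 ^ 2 = ENNReal.ofReal (Real.pi / p.re) := by
  rw [eLpNorm_two_sq, ← integral_univ_inv_sq_add_sq hp p.im,
    ofReal_integral_eq_lintegral_ofReal (integrable_inv_sq_add_sq hp _)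
      (ae_of_all _ fun y => by positivity)]
  refine lintegral_congr fun y => ?_
  rw [← ofReal_norm, ← ENNReal.ofReal_pow (norm_nonneg _), norm_inv, inv_pow, sq_norm_vertical]

theorem add_vertical_ne_zero {p : ℂ} (hp : 0 < p.re) (y : ℝ) : p + y * Complex.I ≠ 0 := by
  intro h
  have := congrArg Complex.re h
  simp at this
  exact hp.ne' this

theorem memLp_inv_vertical {p : ℂ} (hp : 0 < p.re) :
    MemLp (fun y : ℝ => (p + y * Complex.I)⁻¹) 2 := by
  refine ⟨(Continuous.inv₀ (by fun_prop) (add_vertical_ne_zero hp)).aestronglyMeasurable, ?_⟩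
  have h := eLpNorm_inv_vertical_sq hp
  by_contra! h2
  rw [top_le_iff] at h2
  rw [h2] at h
  simp at h

/-- Evaluations at the points of a smaller half-plane are bounded, uniformly in the point. -/
theorem enorm_le_of_eLpNorm_vertical_le {α : ℝ} {F : ℂ → ℂ} {C : ℝ≥0∞}
    (hF : DifferentiableOn ℂ F (halfPlane α))
    (hC : ∀ x : ℝ, -α < x → eLpNorm (fun y : ℝ => F (x + y * Complex.I)) 2 ≤ C)
    {s : ℂ} {r : ℝ} (hr : 0 < r) (hs : r < s.re + α) :
    ‖F s‖ₑ ≤ ENNReal.ofReal (√(2 / (Real.pi * r))) * C := by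
  have h := enorm_sq_le_of_eLpNorm_vertical_le hF hC hr hs
  have hpos : 0 < Real.pi * r ^ 2 := by positivity
  rw [← ENNReal.pow_le_pow_left_iff two_ne_zero, mul_pow, ← ENNReal.ofReal_pow (by positivity),
    Real.sq_sqrt (by positivity)]
  rw [← ENNReal.mul_le_mul_iff_right (a := ENNReal.ofReal (Real.pi * r ^ 2))
    (by simpa using hpos) ENNReal.ofReal_ne_top, ← mul_assoc, ← ENNReal.ofReal_mul hpos.le]
  refine h.trans_eq ?_
  congr 2
  field_simp

/-- Cauchy's theorem for the strip between two vertical lines: the integrals over them agree for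
a holomorphic function that decays like `1 / |y|` in the strip. -/
theorem integral_vertical_eq {α a b B v : ℝ} {Q : ℂ → ℂ} (hQ : DifferentiableOn ℂ Q (halfPlane α))
    (ha : -α < a) (hab : a ≤ b)
    (hB : ∀ x ∈ Icc a b, ∀ y : ℝ, |v| < |y| → ‖Q (x + y * Complex.I)‖ ≤ B / (|y| - |v|))
    (hia : Integrable fun y : ℝ => Q (a + y * Complex.I))
    (hib : Integrable fun y : ℝ => Q (b + y * Complex.I)) :
    ∫ y : ℝ, Q (a + y * Complex.I) = ∫ y : ℝ, Q (b + y * Complex.I) := by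
  have hrect : ∀ T : ℝ, (∫ x : ℝ in a..b, Q (x + (-T : ℝ) * Complex.I)) -
      (∫ x : ℝ in a..b, Q (x + T * Complex.I)) +
      Complex.I • (∫ y : ℝ in (-T)..T, Q (b + y * Complex.I)) -
      Complex.I • (∫ y : ℝ in (-T)..T, Q (a + y * Complex.I)) = 0 := fun T => by
    have := Complex.integral_boundary_rect_eq_zero_of_differentiableOn Q ⟨a, -T⟩ ⟨b, T⟩
      (hQ.mono fun z hz => by
        have h1 := (Complex.mem_reProdIm.mp hz).1
        rw [uIcc_of_le hab] at h1
        exact ha.trans_le h1.1)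
    exact this
  -- The two horizontal sides, `ε = 1` and `ε = -1`, have fixed length and an integrand of size `B /
  -- (T - |v|)`.
  have hhor : ∀ ε : ℝ, |ε| = 1 →
      Tendsto (fun T : ℝ => ∫ x : ℝ in a..b, Q (x + (ε * T : ℝ) * Complex.I)) atTop (𝓝 0) := by
    intro ε hε
    have h0 : Tendsto (fun T : ℝ => B / (T - |v|) * |b - a|) atTop (𝓝 0) := by
      have : Tendsto (fun T : ℝ => T - |v|) atTop atTop := tendsto_atTop_add_const_right _ _ tendsto_id
      simpa using (tendsto_const_nhds (x := B)).div_atTop this |>.mul_const |b - a|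
    refine squeeze_zero_norm' ?_ h0
    filter_upwards [eventually_gt_atTop |v|] with T hT
    refine intervalIntegral.norm_integral_le_of_norm_le_const fun x hx => ?_
    rw [uIoc_of_le hab] at hx
    have hT' : |ε * T| = T := by rw [abs_mul, hε, one_mul, abs_of_pos ((abs_nonneg _).trans_lt hT)]
    have := hB x ⟨hx.1.le, hx.2⟩ (ε * T) (by rwa [hT'])
    rwa [hT'] at this
  have hlim := (((hhor (-1) (by simp)).sub (hhor 1 (by simp))).add
    ((intervalIntegral_tendsto_integral hib tendsto_neg_atTop_atBot tendsto_id).const_smul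
      Complex.I)).sub
    ((intervalIntegral_tendsto_integral hia tendsto_neg_atTop_atBot tendsto_id).const_smul Complex.I)
  have h0 := tendsto_nhds_unique (hlim.congr fun T => by
    have := hrect T
    simpa only [neg_mul, one_mul, id] using this) tendsto_const_nhds
  rw [sub_self, zero_add, sub_eq_zero] at h0
  exact (smul_right_injective ℂ Complex.I_ne_zero h0).symm

/-- The Cauchy integral over a vertical line of a function with bounded `L²` norms
vanishes at its zeros to the right of the line. -/
theorem integral_vertical_eq_zero_of_eq_zero {α a : ℝ} {F : ℂ → ℂ} {C : ℝ≥0∞} {w : ℂ}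
    (hF : DifferentiableOn ℂ F (halfPlane α)) (hCt : C ≠ ∞)
    (hC : ∀ x : ℝ, -α < x → eLpNorm (fun y : ℝ => F (x + y * Complex.I)) 2 ≤ C)
    (ha : -α < a) (haw : a < w.re) (hw : F w = 0) :
    ∫ y : ℝ, F (a + y * Complex.I) * (w - (a + y * Complex.I))⁻¹ = 0 := by
  have hmem : ∀ x : ℝ, -α < x → (x : ℂ) ∈ halfPlane α := fun x hx => by simpa [mem_halfPlane] using hx
  have hLp : ∀ x : ℝ, -α < x → MemLp (fun y : ℝ => F (x + y * Complex.I)) 2 := fun x hx =>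
    ⟨(hF.continuous_vertical (hmem x hx)).aestronglyMeasurable, (hC x hx).trans_lt hCt.lt_top⟩
  -- Since `F w = 0`, this is `F z / (z - w)` with its singularity removed; the line may therefore
  -- be moved across `w`.
  set Q := dslope F w with hQdef
  have hQ : DifferentiableOn ℂ Q (halfPlane α) :=
    (Complex.differentiableOn_dslope ((isOpen_halfPlane α).mem_nhds (ha.trans haw))).mpr hF
  have hQe : ∀ z : ℂ, z ≠ w → Q z = F z * (z - w)⁻¹ := fun z hz => by
    rw [hQdef, dslope_of_ne _ hz, slope_def_field, hw, sub_zero, div_eq_mul_inv]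
  have hline : ∀ x : ℝ, x ≠ w.re → ∀ y : ℝ, (x + y * Complex.I : ℂ) ≠ w := fun x hx y h => by
    have := congrArg Complex.re h
    simp at this
    exact hx this
  have hR : ∀ b : ℝ, w.re < b → (fun y : ℝ => (b + y * Complex.I - w)⁻¹) =
      fun y : ℝ => ((b - w : ℂ) + y * Complex.I)⁻¹ := fun b _ => by
    ext y
    congr 1
    ring
  have hRm : ∀ b : ℝ, w.re < b → MemLp (fun y : ℝ => (b + y * Complex.I - w)⁻¹) 2 := fun b hb => by
    rw [hR b hb]
    exact memLp_inv_vertical (by simpa using hb)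
  -- Here the real part `a - w.re` is negative; a sign change and `y ↦ -y` reduce to the positive
  -- case.
  have hLm : MemLp (fun y : ℝ => (a + y * Complex.I - w)⁻¹) 2 := by
    have h1 : MemLp (fun y : ℝ => ((w - a : ℂ) + y * Complex.I)⁻¹) 2 :=
      memLp_inv_vertical (by simpa using haw)
    have h2 := (h1.comp_measurePreserving (Measure.measurePreserving_neg volume)).neg
    refine h2.ae_eq (ae_of_all _ fun y => ?_)
    simp only [Pi.neg_apply, Function.comp_apply]
    rw [← inv_neg]
    congr 1
    push_cast
    ring
  have hia : Integrable fun y : ℝ => Q (a + y * Complex.I) := by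
    refine ((hLp a ha).integrable_mul hLm).congr (ae_of_all _ fun y => ?_)
    exact (hQe _ (hline a haw.ne y)).symm
  have hib : ∀ b : ℝ, w.re < b → Integrable fun y : ℝ => Q (b + y * Complex.I) := fun b hb => by
    refine ((hLp b (ha.trans (haw.trans hb))).integrable_mul (hRm b hb)).congr (ae_of_all _ fun y => ?_)
    exact (hQe _ (hline b hb.ne' y)).symm
  obtain ⟨r, hr0, hr⟩ : ∃ r : ℝ, 0 < r ∧ r < a + α := exists_between (by linarith)
  set B : ℝ := (ENNReal.ofReal (√(2 / (Real.pi * r))) * C).toReal with hB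
  have hFB : ∀ z : ℂ, a ≤ z.re → ‖F z‖ ≤ B := fun z hz => by
    rw [hB, ← toReal_enorm, ENNReal.toReal_le_toReal (by simp)
      (ENNReal.mul_ne_top ENNReal.ofReal_ne_top hCt)]
    exact enorm_le_of_eLpNorm_vertical_le hF hC hr0 (by linarith)
  have hJ : ∀ b : ℝ, w.re < b →
      ∫ y : ℝ, Q (a + y * Complex.I) = ∫ y : ℝ, Q (b + y * Complex.I) := fun b hb => by
    refine integral_vertical_eq (B := B) (v := w.im) hQ ha (haw.trans hb).le ?_ hia (hib b hb)
    intro x hx y hy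
    have hne : (x + y * Complex.I : ℂ) ≠ w := fun h => by
      have := congrArg Complex.im h
      simp at this
      exact hy.ne (by rw [this])
    rw [hQe _ hne, norm_mul, norm_inv, ← div_eq_mul_inv]
    have him : |y| - |w.im| ≤ ‖(x + y * Complex.I : ℂ) - w‖ := by
      refine (abs_sub_abs_le_abs_sub _ _).trans ?_
      simpa using Complex.abs_im_le_norm ((x + y * Complex.I : ℂ) - w)
    exact div_le_div₀ ((norm_nonneg _).trans (hFB w haw.le)) (hFB _ (by simpa using hx.1))
      (by linarith) him
  -- Cauchy–Schwarz on the line `Re s = b`: `F` stays bounded in `L²` while the Cauchy kernel tends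
  -- to zero as `b → ∞`.
  have hsmall : ∀ b : ℝ, w.re < b →
      ‖∫ y : ℝ, Q (a + y * Complex.I)‖ₑ ^ 2 ≤ C ^ 2 * ENNReal.ofReal (Real.pi / (b - w.re)) := by
    intro b hb
    have hbα := ha.trans (haw.trans hb)
    rw [hJ b hb, integral_congr_ae (ae_of_all _ fun y => hQe _ (hline b hb.ne' y))]
    refine (pow_le_pow_left' (enorm_integral_mul_le_eLpNorm_two (hLp b hbα).1 (hRm b hb).1) 2).trans ?_
    rw [mul_pow, hR b hb, eLpNorm_inv_vertical_sq (by simpa using hb)]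
    simp only [Complex.sub_re, Complex.ofReal_re]
    gcongr
    exact hC b hbα
  have hzero : ∫ y : ℝ, Q (a + y * Complex.I) = 0 := by
    have hlim : Tendsto (fun b : ℝ => C ^ 2 * ENNReal.ofReal (Real.pi / (b - w.re))) atTop (𝓝 0) := by
      have h1 : Tendsto (fun b : ℝ => Real.pi / (b - w.re)) atTop (𝓝 0) :=
        tendsto_const_nhds.div_atTop (tendsto_atTop_add_const_right _ _ tendsto_id)
      simpa using ENNReal.Tendsto.const_mul (ENNReal.tendsto_ofReal h1)
        (Or.inr (ENNReal.pow_ne_top hCt (n := 2)))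
    have h2 := ge_of_tendsto hlim ((eventually_gt_atTop w.re).mono hsmall)
    simpa using h2
  rw [← neg_eq_zero, ← integral_neg, ← hzero]
  refine integral_congr_ae (ae_of_all _ fun y => ?_)
  simp only [hQe _ (hline a haw.ne y)]
  rw [← neg_sub, inv_neg]
  ring

/-- For `z` on the line `Re z = a` and `b` the mirror image of `w` in it, `z - b` is the conjugate
of `w - z`. The product is `|w - z|²`, the denominator of the Poisson kernel. -/
theorem reflected_kernel (w : ℂ) (a y : ℝ) :
    (a + y * Complex.I - (w - 2 * ((w.re - a : ℝ) : ℂ))) * (w - (a + y * Complex.I)) =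
      (((w.re - a) ^ 2 + (y + -w.im) ^ 2 : ℝ) : ℂ) := by
  rcases w with ⟨u, v⟩
  dsimp only
  rw [Complex.mk_eq_add_mul_I]
  push_cast
  linear_combination (-(y - v : ℂ) ^ 2) * Complex.I_sq

/-- Cauchy's formula over a vertical line. -/
theorem integral_vertical_cauchy {α a : ℝ} {F : ℂ → ℂ} {C : ℝ≥0∞} {w : ℂ}
    (hF : DifferentiableOn ℂ F (halfPlane α)) (hCt : C ≠ ∞)
    (hC : ∀ x : ℝ, -α < x → eLpNorm (fun y : ℝ => F (x + y * Complex.I)) 2 ≤ C)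
    (ha : -α < a) (haw : a < w.re) :
    ∫ y : ℝ, F (a + y * Complex.I) * (w - (a + y * Complex.I))⁻¹ = 2 * Real.pi * F w := by
  set d : ℝ := w.re - a with hd
  have hd0 : 0 < d := sub_pos.mpr haw
  -- The mirror image of `w` in the line. Subtracting `F w * φ`, with `φ` having its pole at `b` and
  -- `φ w = 1`, reduces to the case of a zero at `w`; the integral of the subtracted term is an
  -- explicit Poisson integral.
  set b : ℂ := w - 2 * d with hb
  have hbre : b.re = a - d := by simp [hb, hd]; ring
  -- The pole `b` may lie in `halfPlane α`, so the argument moves to a half-plane `Re z > a'` that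
  -- excludes it and still contains the line.
  obtain ⟨a', h1, h2⟩ : ∃ a', max (-α) (a - d) < a' ∧ a' < a :=
    exists_between (max_lt ha (by linarith))
  have ha'α : -α < a' := (le_max_left _ _).trans_lt h1
  have ha'd : a - d < a' := (le_max_right _ _).trans_lt h1
  set φ : ℂ → ℂ := fun z => 2 * d * (z - b)⁻¹ with hφ
  have hφline : ∀ x : ℝ, (fun y : ℝ => (x + y * Complex.I - b)⁻¹) =
      fun y : ℝ => ((x - b : ℂ) + y * Complex.I)⁻¹ := fun x => by
    ext y
    congr 1
    ring
  have hφd : DifferentiableOn ℂ φ (halfPlane (-a')) := by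
    refine DifferentiableOn.const_mul (DifferentiableOn.inv (by fun_prop) fun z hz h => ?_) _
    rw [mem_halfPlane, neg_neg] at hz
    have h3 := congrArg Complex.re h
    rw [Complex.sub_re, hbre, Complex.zero_re] at h3
    linarith
  have hφw : φ w = 1 := by
    have h3 : w - b = 2 * d := by rw [hb]; ring
    simp only [hφ, h3]
    exact mul_inv_cancel₀ (by exact_mod_cast (by positivity : 2 * d ≠ 0))
  have hφC : ∀ x : ℝ, a' < x → eLpNorm (fun y : ℝ => φ (x + y * Complex.I)) 2 ≤
      ‖(2 * d : ℂ)‖ₑ * ENNReal.ofReal (√(Real.pi / (a' - (a - d)))) := fun x hx => by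
    have hp : 0 < (x - b : ℂ).re := by
      rw [Complex.sub_re, hbre, Complex.ofReal_re]
      linarith
    have h3 := eLpNorm_inv_vertical_sq hp
    have h4 := eLpNorm_const_smul (2 * d : ℂ) (fun y : ℝ => (x + y * Complex.I - b)⁻¹) 2 volume
    refine h4.le.trans (mul_le_mul_right ?_ _)
    rw [← ENNReal.pow_le_pow_left_iff two_ne_zero, hφline, h3, ← ENNReal.ofReal_pow (by positivity),
      Real.sq_sqrt (div_nonneg Real.pi_pos.le (by linarith))]
    refine ENNReal.ofReal_le_ofReal (div_le_div_of_nonneg_left Real.pi_pos.le (by linarith) ?_)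
    rw [Complex.sub_re, hbre, Complex.ofReal_re]
    linarith
  have hsub : halfPlane (-a') ⊆ halfPlane α := fun z hz => by
    rw [mem_halfPlane, neg_neg] at hz
    exact ha'α.trans hz
  have hline : ∀ x : ℝ, a' < x → (x : ℂ) ∈ halfPlane (-a') := fun x hx => by
    simpa [mem_halfPlane] using hx
  have hFd := hF.mono hsub
  have hzero := integral_vertical_eq_zero_of_eq_zero (α := -a') (a := a) (w := w)
    (F := fun z => F z - F w * φ z) (C := C + ‖F w‖ₑ * (‖(2 * d : ℂ)‖ₑ *
      ENNReal.ofReal (√(Real.pi / (a' - (a - d))))))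
    (hFd.sub (hφd.const_mul _)) (by finiteness) ?_ (by linarith) haw (by simp [hφw])
  swap
  · intro x hx
    rw [neg_neg] at hx
    have h4 := eLpNorm_const_smul (F w) (fun y : ℝ => φ (x + y * Complex.I)) 2 volume
    refine (eLpNorm_sub_le (hFd.continuous_vertical (hline x hx)).aestronglyMeasurable
      ((hφd.continuous_vertical (hline x hx)).const_smul (F w)).aestronglyMeasurable
      (by norm_num)).trans ?_
    rw [h4]
    gcongr
    · exact hC x (ha'α.trans hx)
    · exact hφC x hx
  have hkm : MemLp (fun y : ℝ => (w - (a + y * Complex.I))⁻¹) 2 := by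
    have h3 : MemLp (fun y : ℝ => ((w - a : ℂ) + y * Complex.I)⁻¹) 2 :=
      memLp_inv_vertical (by simpa using haw)
    refine (h3.comp_measurePreserving (Measure.measurePreserving_neg volume)).ae_eq
      (ae_of_all _ fun y => ?_)
    simp only [Function.comp_apply]
    congr 1
    push_cast
    ring
  have hφe : ∀ y : ℝ, F w * φ (a + y * Complex.I) * (w - (a + y * Complex.I))⁻¹ =
      F w * (2 * d) * (((d ^ 2 + (y + -w.im) ^ 2)⁻¹ : ℝ) : ℂ) := fun y => by
    simp only [hφ]
    rw [mul_assoc, mul_assoc, mul_assoc, ← mul_inv, hb, reflected_kernel, ← hd,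
      ← Complex.ofReal_inv]
    ring
  have hFm : MemLp (fun y : ℝ => F (a + y * Complex.I)) 2 :=
    ⟨(hFd.continuous_vertical (hline a h2)).aestronglyMeasurable, (hC a ha).trans_lt hCt.lt_top⟩
  have hFi : Integrable fun y : ℝ => F (a + y * Complex.I) * (w - (a + y * Complex.I))⁻¹ :=
    hFm.integrable_mul hkm
  have hφi : Integrable fun y : ℝ => F w * φ (a + y * Complex.I) * (w - (a + y * Complex.I))⁻¹ := by
    simp_rw [hφe]
    exact (integrable_inv_sq_add_sq hd0 _).ofReal.const_mul _
  simp only [sub_mul] at hzero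
  rw [integral_sub hFi hφi, sub_eq_zero] at hzero
  rw [hzero]
  simp_rw [hφe]
  rw [integral_const_mul, integral_complex_ofReal, integral_univ_inv_sq_add_sq hd0]
  have : (d : ℂ) ≠ 0 := by exact_mod_cast hd0.ne'
  push_cast
  field_simp

/-! ### The Hilbert space structure and continuity of evaluations. -/

namespace HardySpace

variable {α : ℝ}

theorem norm_def (f : HardySpace α) : ‖f‖ = (hardyENorm f.toFun).toReal := rfl

theorem isHolomorphic_toFun (f : HardySpace α) : IsHolomorphic f.toFun := f.2.1

theorem hardyENorm_toFun_lt_top (f : HardySpace α) : hardyENorm f.toFun < ∞ := f.2.2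

/-- The element of the Hardy space given by a holomorphic function of finite Hardy norm. -/
def ofFun (g : halfPlane α → ℂ) (hg : IsHolomorphic g) (hg' : hardyENorm g < ∞) : HardySpace α :=
  ⟨g, hg, hg'⟩

theorem hardyENorm_toFun (f : HardySpace α) : hardyENorm f.toFun = ENNReal.ofReal ‖f‖ := by
  rw [norm_def, ENNReal.ofReal_toReal f.hardyENorm_toFun_lt_top.ne]

theorem toFun_sub (f g : HardySpace α) : (f - g).toFun = f.toFun - g.toFun := rfl

theorem toFun_injective : Function.Injective (toFun : HardySpace α → halfPlane α → ℂ) :=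
  Subtype.val_injective

theorem eLpNorm_point_le (f : halfPlane α → ℂ) (x : Ioi (-α)) :
    eLpNorm (fun y : ℝ => f (halfPlane.point x y)) 2 ≤ hardyENorm f := by
  rw [hardyENorm_eq]
  exact le_iSup_of_le x le_rfl

/-- Elements of the Hardy space in terms of functions on the plane. -/
theorem exists_extension (f : HardySpace α) : ∃ F : ℂ → ℂ,
    DifferentiableOn ℂ F (halfPlane α) ∧ (∀ s : halfPlane α, F s = f.toFun s) ∧
    (∀ (x : Ioi (-α)) (y : ℝ), F ((x : ℝ) + y * Complex.I) = f.toFun (halfPlane.point x y)) ∧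
    ∀ x : ℝ, -α < x → eLpNorm (fun y : ℝ => F (x + y * Complex.I)) 2 ≤ hardyENorm f.toFun := by
  obtain ⟨F, hF, hFf⟩ := f.isHolomorphic_toFun
  have h : ∀ (x : Ioi (-α)) (y : ℝ), F ((x : ℝ) + y * Complex.I) = f.toFun (halfPlane.point x y) :=
    fun x y => hFf (halfPlane.point x y)
  refine ⟨F, hF, hFf, h, fun x hx => ?_⟩
  have := eLpNorm_point_le f.toFun ⟨x, hx⟩
  simpa only [← h] using this

theorem norm_toFun_le (f : HardySpace α) {s : halfPlane α} {r : ℝ} (hr : 0 < r)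
    (hs : r < (s : ℂ).re + α) : ‖f.toFun s‖ ≤ √(2 / (Real.pi * r)) * ‖f‖ := by
  obtain ⟨F, hF, hFf, -, hC⟩ := f.exists_extension
  have h := enorm_le_of_eLpNorm_vertical_le hF hC hr hs
  rw [hFf, hardyENorm_toFun, ← ENNReal.ofReal_mul (by positivity), ← ofReal_norm,
    ENNReal.ofReal_le_ofReal_iff (by positivity)] at h
  exact h

theorem memLp_point (f : HardySpace α) (x : Ioi (-α)) :
    MemLp (fun y : ℝ => f.toFun (halfPlane.point x y)) 2 :=
  ⟨(f.isHolomorphic_toFun.continuous.comp (halfPlane.continuous_point x)).aestronglyMeasurable,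
    (eLpNorm_point_le _ x).trans_lt f.hardyENorm_toFun_lt_top⟩

/-- Restriction to the vertical line `Re s = x`. -/
noncomputable def line (x : Ioi (-α)) : HardySpace α →ₗ[ℂ] Lp ℂ 2 (volume : Measure ℝ) where
  toFun f := (f.memLp_point x).toLp fun y : ℝ => f.toFun (halfPlane.point x y)
  map_add' f g := (f.memLp_point x).toLp_add (g.memLp_point x)
  map_smul' c f := (f.memLp_point x).toLp_const_smul c

theorem norm_line (x : Ioi (-α)) (f : HardySpace α) :
    ‖line x f‖ = (eLpNorm (fun y : ℝ => f.toFun (halfPlane.point x y)) 2).toReal :=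
  Lp.norm_toLp _ (f.memLp_point x)

/-- The Hardy norm is the limit of the `L²` norms over the vertical lines. -/
theorem tendsto_norm_line (f : HardySpace α) :
    Tendsto (fun x => ‖line x f‖) atBot (𝓝 ‖f‖) := by
  simp_rw [norm_line]
  rw [norm_def]
  refine (ENNReal.tendsto_toReal f.hardyENorm_toFun_lt_top.ne).comp ?_
  rw [hardyENorm_eq]
  refine tendsto_atBot_iSup fun a x hax => ?_
  obtain ⟨F, hF, -, hFf, hC⟩ := f.exists_extension
  simp only [← hFf]
  exact eLpNorm_vertical_antitone hF f.hardyENorm_toFun_lt_top.ne hC a.2 hax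

/-- The parallelogram law holds in `L²` on each line and survives the limit `x → -α`, so the
Jordan–von Neumann theorem applies to the given norm. -/
noncomputable instance : InnerProductSpace ℂ (HardySpace α) :=
  InnerProductSpace.ofNorm ℂ fun f g => by
    have h1 := ((tendsto_norm_line (f + g)).mul (tendsto_norm_line (f + g))).add
      ((tendsto_norm_line (f - g)).mul (tendsto_norm_line (f - g)))
    have h2 := (((tendsto_norm_line f).mul (tendsto_norm_line f)).add
      ((tendsto_norm_line g).mul (tendsto_norm_line g))).const_mul 2
    refine tendsto_nhds_unique (h1.congr fun x => ?_) h2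
    rw [map_add, map_sub]
    exact parallelogram_law_with_norm_mul ℂ (line x f) (line x g)

/-- The inner product is the limit of the `L²` inner products over the vertical lines. -/
theorem tendsto_inner_line (f g : HardySpace α) :
    Tendsto (fun x => inner ℂ (line x f) (line x g)) atBot (𝓝 (inner ℂ f g)) := by
  simp_rw [inner_eq_sum_norm_sq_div_four, ← map_smul, ← map_sub, ← map_add]
  have h : ∀ f : HardySpace α, Tendsto (fun x => (‖line x f‖ : ℂ) ^ 2) atBot (𝓝 ((‖f‖ : ℂ) ^ 2)) :=
    fun f => ((Complex.continuous_ofReal.tendsto _).comp (tendsto_norm_line f)).pow 2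
  exact (((h _).sub (h _)).add (((h _).sub (h _)).mul_const _)).div_const _

/-- Fatou's lemma on each vertical line. Holomorphy of the limit `g` is not needed, so this can be
used before it is known. -/
theorem hardyENorm_le_of_tendsto {v : ℕ → halfPlane α → ℂ} {g : halfPlane α → ℂ} {C : ℝ≥0∞}
    (hv : ∀ n, IsHolomorphic (v n)) (hg : ∀ s, Tendsto (fun n => v n s) atTop (𝓝 (g s)))
    (hC : ∀ᶠ n in atTop, hardyENorm (v n) ≤ C) : hardyENorm g ≤ C := by
  rw [hardyENorm_eq]
  refine iSup_le fun x => ?_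
  refine (Lp.eLpNorm_lim_le_liminf_eLpNorm (fun n => ((hv n).continuous.comp
    (halfPlane.continuous_point x)).aestronglyMeasurable) _ (ae_of_all _ fun y => hg _)).trans
    (liminf_le_of_le (by isBoundedDefault) fun b hb => ?_)
  obtain ⟨n, hn, hn'⟩ := (hb.and hC).exists
  exact hn.trans ((eLpNorm_point_le (v n) x).trans hn')

instance : CompleteSpace (HardySpace α) := by
  refine Metric.complete_of_cauchySeq_tendsto fun u hu => ?_
  have hev : ∀ s : halfPlane α, ∃ c : ℂ, Tendsto (fun n => (u n).toFun s) atTop (𝓝 c) := by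
    intro s
    obtain ⟨r, hr0, hr⟩ : ∃ r : ℝ, 0 < r ∧ r < (s : ℂ).re + α :=
      exists_between (by linarith [mem_halfPlane.mp s.2])
    refine cauchySeq_tendsto_of_complete (Metric.cauchySeq_iff.mpr fun ε hε => ?_)
    obtain ⟨N, hN⟩ := Metric.cauchySeq_iff.mp hu (ε / (√(2 / (Real.pi * r)) + 1)) (by positivity)
    refine ⟨N, fun m hm n hn => ?_⟩
    have h1 := hN m hm n hn
    rw [lt_div_iff₀ (by positivity), dist_eq_norm] at h1
    rw [dist_eq_norm]
    have h2 := norm_toFun_le (u m - u n) hr0 hr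
    rw [toFun_sub, Pi.sub_apply] at h2
    nlinarith [norm_nonneg (u m - u n)]
  choose g hg using hev
  have hclose : ∀ ε : ℝ, 0 < ε → ∃ N, ∀ n ≥ N, hardyENorm (g - (u n).toFun) ≤ ENNReal.ofReal ε ∧
      ∀ m ≥ N, ‖u m - u n‖ ≤ ε := by
    intro ε hε
    obtain ⟨N, hN⟩ := Metric.cauchySeq_iff.mp hu ε hε
    refine ⟨N, fun n hn => ⟨?_, fun m hm => ?_⟩⟩
    · refine hardyENorm_le_of_tendsto (v := fun m => (u m - u n).toFun) (fun m => (u m - u n).isHolomorphic_toFun)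
        (fun s => (hg s).sub_const _) ?_
      filter_upwards [eventually_ge_atTop N] with m hm
      rw [hardyENorm_toFun, ← dist_eq_norm]
      exact ENNReal.ofReal_le_ofReal (hN m hm n hn).le
    · rw [← dist_eq_norm]
      exact (hN m hm n hn).le
  choose F hF hFu _ _ using fun n => (u n).exists_extension
  classical
  have hhol : IsHolomorphic g := by
    refine ⟨fun z => if hz : z ∈ halfPlane α then g ⟨z, hz⟩ else 0, ?_, fun s => by simp⟩
    refine TendstoLocallyUniformlyOn.differentiableOn (F := F) (φ := atTop) ?_
      (Eventually.of_forall hF) (isOpen_halfPlane α)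
    rw [Metric.tendstoLocallyUniformlyOn_iff]
    intro ε hε s hs
    obtain ⟨a, ha, has⟩ := exists_between (mem_halfPlane.mp hs)
    obtain ⟨r, hr0, hr⟩ : ∃ r : ℝ, 0 < r ∧ r < a + α := exists_between (by linarith)
    -- The evaluation constant for `r` serves all of `a < z.re`, so convergence is uniform there.
    -- The factor `2` restores a strict inequality after the limit in `m`.
    obtain ⟨N, hN⟩ := hclose (ε / (2 * (√(2 / (Real.pi * r)) + 1))) (by positivity)
    refine ⟨{z | a < z.re}, mem_nhdsWithin_of_mem_nhds
      ((isOpen_lt continuous_const Complex.continuous_re).mem_nhds has), ?_⟩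
    filter_upwards [eventually_ge_atTop N] with n hn z hz
    have hz' : z ∈ halfPlane α := ha.trans hz
    rw [dif_pos hz', dist_eq_norm, show F n z = (u n).toFun ⟨z, hz'⟩ from hFu n ⟨z, hz'⟩]
    refine lt_of_le_of_lt (le_of_tendsto (((hg ⟨z, hz'⟩).sub_const ((u n).toFun ⟨z, hz'⟩)).norm)
      (b := ε / 2) ?_) (by linarith)
    filter_upwards [eventually_ge_atTop N] with m hm
    have h1 := (hN n hn).2 m hm
    rw [le_div_iff₀ (by positivity)] at h1
    have h2 := norm_toFun_le (u m - u n) (s := ⟨z, hz'⟩) hr0 (hr.trans (by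
      have : a < z.re := hz
      simpa using this))
    rw [toFun_sub, Pi.sub_apply] at h2
    nlinarith [norm_nonneg (u m - u n)]
  have hfin : hardyENorm g < ∞ := by
    obtain ⟨N, hN⟩ := hclose 1 one_pos
    have h1 : IsHolomorphic (g - (u N).toFun) := by
      obtain ⟨G, hG, hGg⟩ := hhol
      exact ⟨G - F N, hG.sub (hF N), fun s => by simp [hGg, hFu]⟩
    have h2 := hardyENorm_add_le h1 (u N).isHolomorphic_toFun
    rw [sub_add_cancel] at h2
    exact h2.trans_lt (ENNReal.add_lt_top.mpr
      ⟨(hN N le_rfl).1.trans_lt ENNReal.ofReal_lt_top, (u N).hardyENorm_toFun_lt_top⟩)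
  refine ⟨ofFun g hhol hfin, ?_⟩
  rw [Metric.tendsto_atTop]
  intro ε hε
  obtain ⟨N, hN⟩ := hclose (ε / 2) (by positivity)
  refine ⟨N, fun n hn => ?_⟩
  rw [dist_comm, dist_eq_norm, norm_def]
  refine lt_of_le_of_lt (ENNReal.toReal_le_of_le_ofReal (by positivity) (hN n hn).1) (by linarith)

noncomputable instance : RKHS ℂ (HardySpace α) (halfPlane α) ℂ where
  coeCLM := ContinuousLinearMap.pi fun s => LinearMap.mkContinuous
    { toFun := fun f => f.toFun s
      map_add' := fun _ _ => rfl
      map_smul' := fun _ _ => rfl }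
    -- The radius is half the distance from `s` to the boundary line.
    (√(2 / (Real.pi * (((s : ℂ).re + α) / 2)))) fun f =>
      f.norm_toFun_le (by linarith [mem_halfPlane.mp s.2]) (by linarith [mem_halfPlane.mp s.2])
  coeCLM_injective f g h := toFun_injective h

theorem coeCLM_eq (f : HardySpace α) : RKHS.coeCLM ℂ f = f.toFun := rfl

end HardySpace

/-! ### The Szegő kernel and its reproducing property. -/

theorem szegoKernel_eq {α : ℝ} (s s₀ : halfPlane α) :
    szegoKernel α s s₀ = (2 * Real.pi : ℂ)⁻¹ * (2 * α + (s : ℂ) + star (s₀ : ℂ))⁻¹ := by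
  rw [szegoKernel, one_div, mul_inv]

theorem szegoKernel_denom_re {α : ℝ} (s s₀ : ℂ) :
    (2 * α + s + star s₀ : ℂ).re = 2 * α + s.re + s₀.re := by
  simp

theorem szegoKernel_denom_ne_zero {α : ℝ} (s s₀ : halfPlane α) :
    (2 * α + s + star (s₀ : ℂ) : ℂ) ≠ 0 := by
  intro h
  have h1 := congrArg Complex.re h
  rw [szegoKernel_denom_re, Complex.zero_re] at h1
  linarith [mem_halfPlane.mp s.2, mem_halfPlane.mp s₀.2]

theorem isHolomorphic_szegoKernel {α : ℝ} (s₀ : halfPlane α) :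
    IsHolomorphic fun s => szegoKernel α s s₀ := by
  refine ⟨fun z => (2 * Real.pi : ℂ)⁻¹ * (2 * α + z + star (s₀ : ℂ))⁻¹, ?_,
    fun s => (szegoKernel_eq s s₀).symm⟩
  exact DifferentiableOn.const_mul (DifferentiableOn.inv (by fun_prop) fun z hz =>
    szegoKernel_denom_ne_zero ⟨z, hz⟩ s₀) _

theorem hardyENorm_szegoKernel_lt_top {α : ℝ} (s₀ : halfPlane α) :
    hardyENorm (fun s => szegoKernel α s s₀) < ∞ := by
  have h0 : 0 < α + (s₀ : ℂ).re := by linarith [mem_halfPlane.mp s₀.2]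
  refine lt_of_le_of_lt (b := ‖(2 * Real.pi : ℂ)⁻¹‖ₑ *
    ENNReal.ofReal (√(Real.pi / (α + (s₀ : ℂ).re)))) ?_ (by finiteness)
  rw [hardyENorm_eq]
  refine iSup_le fun x => ?_
  have hx : -α < (x : ℝ) := x.2
  set p : ℂ := 2 * α + (x : ℝ) + star (s₀ : ℂ) with hp
  have hpre : p.re = 2 * α + (x : ℝ) + (s₀ : ℂ).re := by
    rw [hp, szegoKernel_denom_re, Complex.ofReal_re]
  have hp0 : 0 < p.re := by linarith
  have h1 : (fun y : ℝ => szegoKernel α (halfPlane.point x y) s₀) =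
      (2 * Real.pi : ℂ)⁻¹ • fun y : ℝ => (p + y * Complex.I)⁻¹ := by
    ext y
    rw [szegoKernel_eq, Pi.smul_apply, smul_eq_mul, hp]
    congr 2
    simp only [halfPlane.point]
    ring
  rw [h1, eLpNorm_const_smul]
  refine mul_le_mul_right ?_ _
  rw [← ENNReal.pow_le_pow_left_iff two_ne_zero, eLpNorm_inv_vertical_sq hp0,
    ← ENNReal.ofReal_pow (by positivity), Real.sq_sqrt (by positivity)]
  exact ENNReal.ofReal_le_ofReal (div_le_div_of_nonneg_left Real.pi_pos.le h0 (by linarith))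

namespace HardySpace

variable {α : ℝ}

/-- The Szegő kernel at `s₀` as an element of the Hardy space. -/
noncomputable def szego (s₀ : halfPlane α) : HardySpace α :=
  ofFun (fun s => szegoKernel α s s₀) (isHolomorphic_szegoKernel s₀)
    (hardyENorm_szegoKernel_lt_top s₀)

/-- Over a vertical line, the Szegő kernel evaluates at a point that is shifted to the right. -/
theorem inner_line_szego {F : ℂ → ℂ} (f : HardySpace α) (hF : DifferentiableOn ℂ F (halfPlane α))
    (hFf : ∀ (x : Ioi (-α)) (y : ℝ), F ((x : ℝ) + y * Complex.I) = f.toFun (halfPlane.point x y))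
    (hC : ∀ x : ℝ, -α < x →
      eLpNorm (fun y : ℝ => F (x + y * Complex.I)) 2 ≤ hardyENorm f.toFun)
    (s₀ : halfPlane α) (x : Ioi (-α)) :
    inner ℂ (line x (szego s₀)) (line x f) = F (s₀ + 2 * α + 2 * (x : ℝ)) := by
  have hx : -α < (x : ℝ) := x.2
  -- For `z = x + iy`, the conjugate of `2α + z + star s₀` is `2α + 2x + s₀ - z`, that is, `w - z`.
  have h := integral_vertical_cauchy (w := s₀ + 2 * α + 2 * (x : ℝ)) hF
    f.hardyENorm_toFun_lt_top.ne hC hx (by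
      simp
      linarith [mem_halfPlane.mp s₀.2])
  have hpi : (2 * Real.pi : ℂ) ≠ 0 := by exact_mod_cast (by positivity : 2 * Real.pi ≠ 0)
  rw [L2.inner_def, ← inv_mul_cancel_left₀ hpi (F _), ← h, ← integral_const_mul]
  refine integral_congr_ae ?_
  filter_upwards [((szego s₀).memLp_point x).coeFn_toLp, (f.memLp_point x).coeFn_toLp] with y h1 h2
  have h1' : line x (szego s₀) y = szegoKernel α (halfPlane.point x y) s₀ := h1
  have h2' : line x f y = f.toFun (halfPlane.point x y) := h2
  rw [h1', h2', RCLike.inner_apply, ← hFf, szegoKernel_eq]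
  simp only [halfPlane.point, map_mul, map_inv₀, map_add, Complex.conj_ofReal, Complex.conj_I,
    Complex.star_def, Complex.conj_conj, Complex.conj_ofNat]
  rw [mul_left_comm]
  congr 3
  ring

/-- The reproducing property of the Szegő kernel. -/
theorem inner_szego (s₀ : halfPlane α) (f : HardySpace α) :
    inner ℂ (szego s₀) f = f.toFun s₀ := by
  obtain ⟨F, hF, hFs, hFf, hC⟩ := f.exists_extension
  refine tendsto_nhds_unique (tendsto_inner_line (szego s₀) f) ?_
  simp_rw [inner_line_szego f hF hFf hC, ← hFs]
  have hc : ContinuousAt F s₀ :=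
    (hF.differentiableAt ((isOpen_halfPlane α).mem_nhds s₀.2)).continuousAt
  have hx : Tendsto (fun x : Ioi (-α) => (x : ℝ)) atBot (𝓝 (-α)) := by
    have : Tendsto (fun x : ℝ => x) (𝓝[>] (-α)) (𝓝 (-α)) :=
      tendsto_id.mono_left nhdsWithin_le_nhds
    exact (tendsto_comp_coe_Ioi_atBot (f := fun x : ℝ => x)).mpr this
  refine hc.tendsto.comp ?_
  have h1 : Tendsto (fun x : Ioi (-α) => (s₀ + 2 * α + 2 * (x : ℝ) : ℂ)) atBot
      (𝓝 (s₀ + 2 * α + 2 * (-α : ℝ))) :=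
    (((Complex.continuous_ofReal.tendsto _).comp hx).const_mul 2).const_add _
  convert h1 using 2
  push_cast
  ring

/-- `RKHS.kernel` is operator-valued; with values in `ℂ`, applying it to `1` recovers the scalar
kernel. -/
theorem kernel_eq (s s₀ : halfPlane α) :
    RKHS.kernel (HardySpace α) s s₀ 1 = szegoKernel α s s₀ := by
  have h : RKHS.kerFun (HardySpace α) s₀ 1 = szego s₀ := by
    refine ext_inner_right ℂ fun f => ?_
    rw [RKHS.kerFun_inner, inner_szego]
    change inner ℂ 1 (f.toFun s₀) = f.toFun s₀
    simp
  rw [← RKHS.kerFun_apply, h]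
  rfl

theorem inner_szego_szego (s s₀ : halfPlane α) :
    inner ℂ (szego s) (szego s₀) = szegoKernel α s s₀ :=
  inner_szego s (szego s₀)

end HardySpace

/-! ### Strict positive definiteness. -/

-- The quadratic form is the squared norm of `∑ aᵢ • szego (sᵢ)`.
open scoped ComplexOrder in
theorem isPosDefKernel_szegoKernel (α : ℝ) : IsPosDefKernel (szegoKernel α) := by
  intro n s a
  have h : ∑ i, ∑ j, star (a i) * a j * szegoKernel α (s i) (s j) =
      inner ℂ (∑ i, a i • HardySpace.szego (s i)) (∑ i, a i • HardySpace.szego (s i)) := by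
    simp only [sum_inner, inner_sum, inner_smul_left, inner_smul_right,
      HardySpace.inner_szego_szego, Finset.mul_sum]
    rw [Finset.sum_comm]
    refine Finset.sum_congr rfl fun j _ => Finset.sum_congr rfl fun i _ => ?_
    rw [Complex.star_def]
    ring
  rw [h, inner_self_eq_norm_sq_to_K]
  refine (Complex.zero_le_real.mpr (sq_nonneg ‖∑ i, a i • HardySpace.szego (s i)‖)).trans_eq ?_
  exact Complex.ofReal_pow _ 2

open Polynomial in
/-- A linear combination of distinct simple fractions with as many distinct zeros as terms
is trivial. -/
theorem eq_zero_of_sum_div_sub_eq_zero {K : Type*} [Field K] {n : ℕ} {x p v : Fin n → K}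
    (hx : Function.Injective x) (hp : Function.Injective p) (hxp : ∀ i j, x i - p j ≠ 0)
    (h : ∀ i, ∑ j, v j * (x i - p j)⁻¹ = 0) : v = 0 := by
  classical
  -- The numerator over the common denominator: its degree is below `n` and it has the `n` roots `x
  -- i`, so it vanishes. At the pole `p j` only the `j`-th term survives, which isolates `v j`.
  set P : K[X] := ∑ j, C (v j) * ∏ l ∈ Finset.univ.erase j, (X - C (p l)) with hP
  have hdeg : P.degree < n := by
    rw [hP]
    refine (degree_sum_le _ _).trans_lt ((Finset.sup_lt_iff (WithBot.bot_lt_coe n)).mpr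
      fun j _ => ?_)
    have hn : 0 < n := j.pos
    rw [← smul_eq_C_mul]
    refine lt_of_le_of_lt (degree_smul_le _ _) ?_
    rw [degree_prod]
    simp only [degree_X_sub_C, Finset.sum_const, Finset.card_erase_of_mem (Finset.mem_univ j),
      Finset.card_univ, Fintype.card_fin, nsmul_eq_mul, mul_one]
    exact Nat.cast_lt.mpr (Nat.sub_lt hn one_pos)
  have hP0 : P = 0 := by
    refine eq_zero_of_degree_lt_of_eval_index_eq_zero Finset.univ hx.injOn
      (by simpa using hdeg) fun i _ => ?_
    have h1 : P.eval (x i) = (∏ l, (x i - p l)) * ∑ j, v j * (x i - p j)⁻¹ := by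
      rw [hP, eval_finsetSum, Finset.mul_sum]
      refine Finset.sum_congr rfl fun j _ => ?_
      rw [eval_mul, eval_C, eval_prod, ← Finset.mul_prod_erase _ _ (Finset.mem_univ j)]
      simp only [eval_sub, eval_X, eval_C]
      field_simp [hxp i j]
    rw [h1, h i, mul_zero]
  ext j
  have h2 : P.eval (p j) = v j * ∏ l ∈ Finset.univ.erase j, (p j - p l) := by
    rw [hP, eval_finsetSum, Finset.sum_eq_single j]
    · simp [eval_prod]
    · intro i _ hij
      rw [eval_mul, eval_prod, Finset.prod_eq_zero (i := j) (by simp [hij.symm]) (by simp),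
        mul_zero]
    · simp
  rw [hP0, eval_zero, eq_comm, mul_eq_zero] at h2
  refine h2.resolve_right (Finset.prod_ne_zero_iff.mpr fun l hl => ?_)
  exact sub_ne_zero.mpr fun e => (Finset.ne_of_mem_erase hl) (hp e).symm

/-- Up to the factor `1 / 2π` the kernel matrix is a Cauchy matrix with nodes `sᵢ` and poles `-(2α +
star sⱼ)`, the reflections of the nodes in the boundary line. -/
theorem isStrictlyPosDefKernel_szegoKernel (α : ℝ) :
    IsStrictlyPosDefKernel (szegoKernel α) := by
  refine ⟨isPosDefKernel_szegoKernel α, fun n s hs => ?_⟩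
  rw [← Matrix.mulVec_injective_iff_isUnit, ← Matrix.coe_mulVecLin, injective_iff_map_eq_zero]
  intro v hv
  refine eq_zero_of_sum_div_sub_eq_zero (x := fun i => (s i : ℂ))
    (p := fun j => -(2 * α + star (s j : ℂ))) (Subtype.val_injective.comp hs) (fun i j hij => ?_)
    (fun i j => ?_) fun i => ?_
  · exact hs (Subtype.ext (star_injective (add_left_cancel (neg_injective hij))))
  · convert szegoKernel_denom_ne_zero (s i) (s j) using 1
    ring
  · have h1 := congrFun hv i
    have hpi : (2 * Real.pi : ℂ)⁻¹ ≠ 0 :=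
      inv_ne_zero (by exact_mod_cast (by positivity : 2 * Real.pi ≠ 0))
    refine (mul_eq_zero.mp ?_).resolve_left hpi
    rw [Finset.mul_sum]
    refine Eq.trans ?_ h1
    simp only [Matrix.mulVecLin_apply, Matrix.mulVec, dotProduct, Matrix.of_apply]
    refine Finset.sum_congr rfl fun j _ => ?_
    rw [szegoKernel_eq, show (s i : ℂ) - -(2 * α + star (s j : ℂ)) = 2 * α + s i + star (s j : ℂ) by
      ring]
    ring

/-- The Hardy space `H²(Γ_α)` with its norm is a Hilbert space of functions on `Γ_α` (a complete
inner product space on whose elements, viewed as functions, point evaluation is continuous).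
Its reproducing kernel is the Szegő kernel, which is strictly positive definite. -/
theorem mainTheorem5 (α : ℝ) :
    ∃ (ip : InnerProductSpace ℂ (HardySpace α)) (_ : CompleteSpace (HardySpace α))
      (_ : RKHS ℂ (HardySpace α) (halfPlane α) ℂ),
      (∀ f : HardySpace α, RKHS.coeCLM ℂ f = f.toFun) ∧
      (∀ s s₀ : halfPlane α, RKHS.kernel (HardySpace α) s s₀ 1 = szegoKernel α s s₀) ∧
      (∀ s₀ : halfPlane α, ∃ g : HardySpace α, g.toFun = (fun s => szegoKernel α s s₀) ∧
        ∀ f : HardySpace α, f.toFun s₀ = ip.toInner.inner g f) ∧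
      IsStrictlyPosDefKernel (szegoKernel α) :=
  ⟨inferInstance, inferInstance, inferInstance, HardySpace.coeCLM_eq, HardySpace.kernel_eq,
    -- `inner` is conjugate-linear in its first argument, so the kernel function stands on the left.
    fun s₀ => ⟨HardySpace.szego s₀, rfl, fun f => (HardySpace.inner_szego s₀ f).symm⟩,
    isStrictlyPosDefKernel_szegoKernel α⟩
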